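/- Let $\frac12<p\le 1$ and $0\le\lambda\le 1$, and let $\omega:\mathbb Z\to[0,1]$ be a $(p,\lambda)$ environment, that is, for every $x\in\mathbb Z$ either $\omega(x)=\frac12$ or $\omega(x)=p$, and $$\limsup_{n\to\infty}\frac1{n+1}\sum_{x=0}^{n}\mathbf 1_{\{\omega(x)=p\}}=\lambda .$$ For $x\in\mathbb Z$ let $\mathbf P^x_\omega$ be the law of the random walk $\{X_n\}_{n\ge0}$ on $\mathbb Z$ in the environment $\omega$ started at $x$, that is, of the time-homogeneous Markov chain with $\mathbf P^x_\omega(X_0=x)=1$ and, for every $n\ge 0$ and $y,z\in\mathbb Z$, $$\mathbf P^x_\omega(X_{n+1}=y\mid X_n=z)=\begin{cases}\omega(z)&y=z+1,\\ 1-\omega(z)&y=z-1,\\ 0&\text{otherwise.}\end{cases}$$ Then for every such environment $\omega$ and every $x\in\mathbb Z$, $$\limsup_{n\to\infty}\frac{X_n}{n}\le(2p-1)\lambda\qquad \mathbf P^x_\omega\text{-almost surely.}$$ -/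

import Mathlib

open MeasureTheory ProbabilityTheory Filter

/-- `ω : ℤ → [0,1]` is a `(p, lam)` environment: every site carries the right-step probability
`1/2` or `p`, and the upper density of the `p`-sites in `{0, 1, 2, …}` equals `lam`.
(The averages below lie in `[0, 1]`, so the real `limsup` is the genuine one.) -/
structure IsEnvironment (p lam : ℝ) (ω : ℤ → Set.Icc (0 : ℝ) 1) : Prop where
  values : ∀ x : ℤ, (ω x : ℝ) = 1 / 2 ∨ (ω x : ℝ) = p
  density : limsup (fun n : ℕ => 1 / ((n : ℝ) + 1) *
    ∑ x ∈ Finset.range (n + 1), Set.indicator {z : ℤ | (ω z : ℝ) = p} (fun _ => (1 : ℝ)) (x : ℤ))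
    atTop = lam

/-- The one-step transition probability from `z` to `y` in the environment `ω`. -/
noncomputable def stepProb (ω : ℤ → Set.Icc (0 : ℝ) 1) (z y : ℤ) : ℝ :=
  if y = z + 1 then (ω z : ℝ) else if y = z - 1 then 1 - (ω z : ℝ) else 0

/-- Under `P`, the process `X` is the random walk in the fixed environment `ω` started at `x`:
the time-homogeneous Markov chain on `ℤ` with `X 0 = x` almost surely and transition
probabilities `stepProb ω`. The Markov property is written without division: for every path
`a 0, …, a n` and every `y`,
`P(X_0 = a_0, …, X_n = a_n, X_{n+1} = y) = P(X_0 = a_0, …, X_n = a_n) * stepProb ω (a n) y`. -/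
structure IsRandomWalk {Ω : Type*} [MeasurableSpace Ω] (P : Measure Ω)
    (ω : ℤ → Set.Icc (0 : ℝ) 1) (x : ℤ) (X : ℕ → Ω → ℤ) : Prop where
  measurable : ∀ n, Measurable (X n)
  start : ∀ᵐ s ∂P, X 0 s = x
  step : ∀ (n : ℕ) (a : ℕ → ℤ) (y : ℤ),
    P.real {s | (∀ i ≤ n, X i s = a i) ∧ X (n + 1) s = y} =
      P.real {s | ∀ i ≤ n, X i s = a i} * stepProb ω (a n) y

/-- The law of the next position, as a measure on `ℤ`. -/
noncomputable def stepMeasure (ω : ℤ → Set.Icc (0 : ℝ) 1) (z : ℤ) : Measure ℤ :=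
  ENNReal.ofReal (ω z) • Measure.dirac (z + 1) +
    ENNReal.ofReal (1 - (ω z : ℝ)) • Measure.dirac (z - 1)

/-- The transition kernels of the walk, as functions of the trajectory up to time `n`. -/
noncomputable def stepKernel (ω : ℤ → Set.Icc (0 : ℝ) 1) (n : ℕ) :
    Kernel ((i : Finset.Iic n) → (fun _ : ℕ => ℤ) i) ℤ where
  toFun h := stepMeasure ω (h ⟨n, Finset.mem_Iic.2 le_rfl⟩)
  measurable' := (Measurable.of_discrete (f := stepMeasure ω)).comp
    (measurable_pi_apply (⟨n, Finset.mem_Iic.2 le_rfl⟩ : Finset.Iic n))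

instance (ω : ℤ → Set.Icc (0 : ℝ) 1) (n : ℕ) : IsMarkovKernel (stepKernel ω n) where
  isProbabilityMeasure h := ⟨by
    have h0 := (ω (h ⟨n, Finset.mem_Iic.2 le_rfl⟩)).2.1
    have h1 := (ω (h ⟨n, Finset.mem_Iic.2 le_rfl⟩)).2.2
    change stepMeasure ω (h ⟨n, Finset.mem_Iic.2 le_rfl⟩) Set.univ = 1
    simp only [stepMeasure, Measure.coe_add, Measure.coe_smul, Pi.add_apply, Pi.smul_apply,
      measure_univ, smul_eq_mul, mul_one]
    rw [← ENNReal.ofReal_add h0 (by linarith)]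
    simp⟩

/-- The law of the walk in the environment `ω` started at `x`, as a measure on the space of
trajectories (built by the Ionescu-Tulcea theorem). -/
noncomputable def walkLaw (ω : ℤ → Set.Icc (0 : ℝ) 1) (x : ℤ) : Measure (ℕ → ℤ) :=
  Kernel.traj (X := fun _ => ℤ) (stepKernel ω) 0 (fun _ => x)

instance (ω : ℤ → Set.Icc (0 : ℝ) 1) (x : ℤ) : IsProbabilityMeasure (walkLaw ω x) := by
  unfold walkLaw; infer_instance

lemma stepMeasure_singleton (ω : ℤ → Set.Icc (0 : ℝ) 1) (z y : ℤ) :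
    (stepMeasure ω z).real {y} = stepProb ω z y := by
  have h0 := (ω z).2.1
  have h1 := (ω z).2.2
  have h2 : z + 1 ≠ z - 1 := by omega
  simp only [stepMeasure, stepProb, measureReal_def, Measure.coe_add, Measure.coe_smul,
    Pi.add_apply, Pi.smul_apply, smul_eq_mul, Measure.dirac_apply, Set.indicator,
    Set.mem_singleton_iff, Pi.one_apply]
  by_cases hy : y = z + 1
  · subst hy
    simp [h0, h2.symm]
  · by_cases hy' : y = z - 1
    · subst hy'
      simp only [hy, if_false, if_true]
      simp [h2, h1]
    · simp [hy, hy', Ne.symm hy, Ne.symm hy']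

/-- The walk exists: the coordinate process under `walkLaw ω x` is the walk started at `x`. -/
theorem isRandomWalk_walkLaw (ω : ℤ → Set.Icc (0 : ℝ) 1) (x : ℤ) :
    IsRandomWalk (walkLaw ω x) ω x (fun n s => s n) where
  measurable n := measurable_pi_apply n
  start := by
    have h := Kernel.traj_map_frestrictLe_apply (X := fun _ => ℤ) (κ := stepKernel ω) 0 0
      (fun _ => x)
    rw [Kernel.partialTraj_self, Kernel.id_apply] at h
    have hS : MeasurableSet {f : (i : Finset.Iic 0) → (fun _ : ℕ => ℤ) i |
        f ⟨0, Finset.mem_Iic.2 le_rfl⟩ = x} :=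
      measurableSet_eq_fun (measurable_pi_apply _) measurable_const
    have h2 : ∀ᵐ f ∂((walkLaw ω x).map (Preorder.frestrictLe (π := fun _ : ℕ => ℤ) 0)),
        f ⟨0, Finset.mem_Iic.2 le_rfl⟩ = x := by
      unfold walkLaw
      rw [h, ae_dirac_iff hS]
    exact ae_of_ae_map (by fun_prop) h2
  step n a y := by
    have h := Kernel.partialTraj_compProd_eq_map_traj (X := fun _ => ℤ) (κ := stepKernel ω)
      (Nat.zero_le n) (x₀ := fun _ => x)
    rw [← Kernel.traj_map_frestrictLe_apply] at h
    change (walkLaw ω x).map _ ⊗ₘ _ = (walkLaw ω x).map _ at h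
    set b : (i : Finset.Iic n) → (fun _ : ℕ => ℤ) i := fun i => a i with hb
    have hpre : Preorder.frestrictLe (π := fun _ : ℕ => ℤ) n ⁻¹' {b} =
        {s | ∀ i ≤ n, s i = a i} := by
      ext s
      simp only [Set.mem_preimage, Set.mem_singleton_iff, funext_iff, hb,
        Preorder.frestrictLe_apply, Subtype.forall, Finset.mem_Iic, Set.mem_ofPred_eq]
    have hmb : MeasurableSet ({b} : Set ((i : Finset.Iic n) → (fun _ : ℕ => ℤ) i)) :=
      MeasurableSet.singleton _
    have h3 := congrArg (fun μ => μ ({b} ×ˢ {y})) h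
    simp only at h3
    rw [Measure.compProd_apply_prod hmb (measurableSet_singleton y),
      Measure.map_apply (by fun_prop) (hmb.prod (measurableSet_singleton y)),
      Measure.restrict_singleton, lintegral_smul_measure, lintegral_dirac,
      Measure.map_apply (by fun_prop) hmb, hpre] at h3
    have hset : {s : ℕ → ℤ | (∀ i ≤ n, s i = a i) ∧ s (n + 1) = y} =
        (fun s : ℕ → ℤ => (Preorder.frestrictLe (π := fun _ : ℕ => ℤ) n s, s (n + 1))) ⁻¹'
          ({b} ×ˢ {y}) := by
      rw [Set.mk_preimage_prod, hpre]
      rfl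
    rw [hset, measureReal_def, ← h3, smul_eq_mul, ENNReal.toReal_mul,
      ← stepMeasure_singleton]
    rfl

/-! Let E_n be the expected time to go from n - 1 to n with reflection at 0, and H(z) = E_1 + ... +
E_z, with H = 0 for z ≤ 0. The walk raises H by at most 1 per step on average
(`crossingTime_drift_le_one`). Capping the E_n at K keeps this and bounds the increments of H, so a
Chernoff bound and Borel–Cantelli give H(X_n) ≤ (1 + ε)n eventually.

It remains to see that H grows at least like z / ((2p-1)r) for every r > λ, however the p-sites are
placed. For each admissible t, a quadratic function of E_n telescopes to H(n) ≥ 2tn - (2p-1)t² N_n -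
O(1), where N_n counts the p-sites below n (`sum_crossingTime_ge`). Since N_n ≤ rn + C, taking t =
1/((2p-1)r) gives the rate. Then r ↓ λ and ε ↓ 0. -/

/-! ### Truncated crossing times and their potential -/

/-- The expected time to step from `n - 1` to `n` for the walk reflected at the origin,
truncated at the level `K`. -/
noncomputable def crossingTime (ω : ℤ → Set.Icc (0 : ℝ) 1) (K : ℝ) : ℕ → ℝ
  | 0 => 0
  | n + 1 => min K (1 / (ω n : ℝ) + (1 - (ω n : ℝ)) / (ω n : ℝ) * crossingTime ω K n)

/-- The accumulated truncated crossing times between the origin and `z`. -/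
noncomputable def hittingPotential (ω : ℤ → Set.Icc (0 : ℝ) 1) (K : ℝ) (z : ℤ) : ℝ :=
  ∑ i ∈ Finset.range z.toNat, crossingTime ω K (i + 1)

lemma crossingTime_mem_Icc (ω : ℤ → Set.Icc (0 : ℝ) 1) {K : ℝ} (hK : 0 ≤ K) (n : ℕ) :
    crossingTime ω K n ∈ Set.Icc 0 K := by
  induction n with
  | zero => simp [crossingTime, hK]
  | succ n ih =>
    have h0 := (ω n).2.1
    have h1 := sub_nonneg.2 (ω n).2.2
    have h2 := ih.1
    refine ⟨le_min hK ?_, min_le_left _ _⟩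
    positivity

lemma hittingPotential_add_one (ω : ℤ → Set.Icc (0 : ℝ) 1) (K : ℝ) (z : ℤ) :
    hittingPotential ω K (z + 1) =
      hittingPotential ω K z + crossingTime ω K (z + 1).toNat := by
  unfold hittingPotential
  rcases lt_or_ge z 0 with hz | hz
  · have h1 : (z + 1).toNat = 0 := by omega
    have h2 : z.toNat = 0 := by omega
    simp [h1, h2, crossingTime]
  · have h1 : (z + 1).toNat = z.toNat + 1 := by omega
    rw [h1, Finset.sum_range_succ]

lemma hittingPotential_sub_one (ω : ℤ → Set.Icc (0 : ℝ) 1) (K : ℝ) (z : ℤ) :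
    hittingPotential ω K (z - 1) = hittingPotential ω K z - crossingTime ω K z.toNat := by
  have h := hittingPotential_add_one ω K (z - 1)
  rw [sub_add_cancel] at h
  linarith

/-- At z ≥ 0 the recursion without the cap gives equality, and the cap only lowers the term at z +
1. At z < 0 both terms vanish. -/
lemma crossingTime_drift_le_one (ω : ℤ → Set.Icc (0 : ℝ) 1) (K : ℝ) (z : ℤ)
    (hz : 0 < (ω z : ℝ)) :
    (ω z : ℝ) * crossingTime ω K (z + 1).toNat -
      (1 - (ω z : ℝ)) * crossingTime ω K z.toNat ≤ 1 := by
  rcases lt_or_ge z 0 with h | h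
  · have h1 : (z + 1).toNat = 0 := by omega
    have h2 : z.toNat = 0 := by omega
    simp [h1, h2, crossingTime]
  · lift z to ℕ using h
    have h1 : ((z : ℤ) + 1).toNat = z + 1 := by omega
    rw [h1, Int.toNat_natCast, crossingTime]
    have h3 := mul_le_mul_of_nonneg_left (min_le_right K
      (1 / (ω z : ℝ) + (1 - (ω z : ℝ)) / (ω z : ℝ) * crossingTime ω K z)) hz.le
    have h4 : (ω z : ℝ) * (1 / (ω z : ℝ) + (1 - (ω z : ℝ)) / (ω z : ℝ) * crossingTime ω K z) =
        1 + (1 - (ω z : ℝ)) * crossingTime ω K z := by field_simp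
    linarith

/-! ### Linear growth of the potential -/

/-- Let Φ(u) = u²/4 + (1-2t)u/2. It is chosen so that an uncapped 1/2-site, where u becomes u + 2,
gives equality; a p-site then costs at most (2p-1)t². -/
lemma crossingTime_potential_step {p : ℝ} (hp : 1 / 2 < p) (ω : ℤ → Set.Icc (0 : ℝ) 1)
    {K t : ℝ} (hKp : 1 / (2 * p - 1) ≤ K) (hKt : 2 * t + 1 ≤ K) (hK : 0 ≤ K) (n : ℕ)
    (hv : (ω n : ℝ) = 1 / 2 ∨ (ω n : ℝ) = p) :
    2 * t + (crossingTime ω K (n + 1) ^ 2 / 4 + (1 - 2 * t) * crossingTime ω K (n + 1) / 2) ≤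
      (crossingTime ω K n ^ 2 / 4 + (1 - 2 * t) * crossingTime ω K n / 2) +
      crossingTime ω K (n + 1) +
      (2 * p - 1) * t ^ 2 *
        Set.indicator {z : ℤ | (ω z : ℝ) = p} (fun _ => (1 : ℝ)) (n : ℤ) := by
  obtain ⟨hE0, hEK⟩ := crossingTime_mem_Icc ω hK n
  rw [crossingTime]
  set E := crossingTime ω K n
  rcases hv with hv | hv
  · have hne : ¬ (ω n : ℝ) = p := by rw [hv]; exact hp.ne
    rw [Set.indicator_of_notMem (by exact hne), hv]
    have h1 : (1 : ℝ) / (1 / 2) + (1 - 1 / 2) / (1 / 2) * E = E + 2 := by ring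
    rw [h1]
    -- Φ(u) - u is nondecreasing for u ≥ 2t + 1, so capping at K ≥ 2t + 1 preserves the inequality.
    rcases le_total K (E + 2) with h | h
    · rw [min_eq_left h]
      nlinarith [mul_nonneg (sub_nonneg.2 h) (sub_nonneg.2 hKt),
        mul_nonneg (sub_nonneg.2 h) (sub_nonneg.2 hEK)]
    · rw [min_eq_right h]
      nlinarith
  · rw [Set.indicator_of_mem (by exact hv), hv]
    have hp0 : 0 < p := by linarith
    have hd : 0 < 2 * p - 1 := by linarith
    have hp1 : p ≤ 1 := hv ▸ (ω n).2.2
    -- The affine map at a p-site has fixed point 1/(2p-1) ≤ K and preserves [0, K], so the cap is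
    -- inactive.
    have h1 : 1 / p + (1 - p) / p * E ≤ K := by
      rw [div_le_iff₀ hd] at hKp
      rw [div_mul_eq_mul_div, ← add_div, div_le_iff₀ hp0]
      nlinarith
    rw [min_eq_right h1, ← sub_nonneg]
    -- This square is exactly the slack in the inequality.
    have h2 : 0 ≤ (2 * p - 1) / (4 * p ^ 2) * (E + 1 - 2 * p * t) ^ 2 := by positivity
    convert h2 using 1
    field_simp
    ring

lemma sum_crossingTime_ge {p : ℝ} (hp : 1 / 2 < p) (ω : ℤ → Set.Icc (0 : ℝ) 1)
    (hv : ∀ x : ℤ, (ω x : ℝ) = 1 / 2 ∨ (ω x : ℝ) = p)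
    {K t : ℝ} (hKp : 1 / (2 * p - 1) ≤ K) (hKt : 2 * t + 1 ≤ K) (hK : 0 ≤ K) (n : ℕ) :
    2 * t * n - (2 * p - 1) * t ^ 2 * ∑ x ∈ Finset.range n,
        Set.indicator {z : ℤ | (ω z : ℝ) = p} (fun _ => (1 : ℝ)) (x : ℤ) - (1 - 2 * t) ^ 2 / 4 ≤
      ∑ i ∈ Finset.range n, crossingTime ω K (i + 1) := by
  have key : 2 * t * n +
      (crossingTime ω K n ^ 2 / 4 + (1 - 2 * t) * crossingTime ω K n / 2) ≤
      ∑ i ∈ Finset.range n, crossingTime ω K (i + 1) +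
      (2 * p - 1) * t ^ 2 * ∑ x ∈ Finset.range n,
        Set.indicator {z : ℤ | (ω z : ℝ) = p} (fun _ => (1 : ℝ)) (x : ℤ) := by
    induction n with
    | zero => simp [crossingTime]
    | succ n ih =>
      have h := crossingTime_potential_step hp ω hKp hKt hK n (hv n)
      rw [Finset.sum_range_succ, Finset.sum_range_succ, mul_add]
      push_cast
      linarith
  -- Completing the square: Φ is bounded below by -(1-2t)²/4.
  nlinarith [sq_nonneg (crossingTime ω K n + (1 - 2 * t))]

lemma IsEnvironment.exists_sum_indicator_le {p lam : ℝ} {ω : ℤ → Set.Icc (0 : ℝ) 1}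
    (hω : IsEnvironment p lam ω) {r : ℝ} (hr : lam < r) :
    ∃ C : ℝ, ∀ n : ℕ, ∑ x ∈ Finset.range n,
      Set.indicator {z : ℤ | (ω z : ℝ) = p} (fun _ => (1 : ℝ)) (x : ℤ) ≤ r * n + C := by
  set f : ℕ → ℝ := fun n => ∑ x ∈ Finset.range n,
      Set.indicator {z : ℤ | (ω z : ℝ) = p} (fun _ => (1 : ℝ)) (x : ℤ) with hf
  have hle : ∀ n, f n ≤ n := fun n => by
    calc f n ≤ ∑ _x ∈ Finset.range n, (1 : ℝ) := Finset.sum_le_sum fun x _ => by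
          apply Set.indicator_le_self' (fun _ _ => zero_le_one)
      _ = n := by simp
  have hev := eventually_lt_of_limsup_lt (hω.density.trans_lt hr)
    (isBoundedUnder_of ⟨1, fun n => by
      have h := hle (n + 1)
      push_cast at h
      rw [one_div_mul_eq_div, div_le_one (by positivity)]
      exact h⟩)
  obtain ⟨N, hN⟩ := eventually_atTop.1 hev
  -- For n ≤ N the trivial count n suffices; |r| allows for negative r.
  refine ⟨(N + 1) * (1 + |r|), fun n => ?_⟩
  have hr1 : -|r| ≤ r := neg_abs_le r
  have hr0 := abs_nonneg r
  rcases le_or_gt n N with h | h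
  · have h1 := hle n
    have h2 : (n : ℝ) ≤ N := by exact_mod_cast h
    have h3 : (0 : ℝ) ≤ n := n.cast_nonneg
    nlinarith
  · obtain ⟨m, rfl⟩ : ∃ m, n = m + 1 := ⟨n - 1, by omega⟩
    have h1 := hN m (by omega)
    rw [one_div_mul_eq_div, div_lt_iff₀ (by positivity)] at h1
    push_cast
    have : 0 ≤ ((N : ℝ) + 1) * (1 + |r|) := by positivity
    linarith

lemma IsEnvironment.exists_le_hittingPotential {p lam : ℝ} (hp : 1 / 2 < p)
    {ω : ℤ → Set.Icc (0 : ℝ) 1} (hω : IsEnvironment p lam ω) {r : ℝ} (hr : lam < r)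
    (hr0 : 0 < r) {K : ℝ} (hKp : 1 / (2 * p - 1) ≤ K)
    (hKr : 2 * (1 / ((2 * p - 1) * r)) + 1 ≤ K) (hK : 0 ≤ K) :
    ∃ C : ℝ, ∀ z : ℤ, z / ((2 * p - 1) * r) ≤ hittingPotential ω K z + C := by
  obtain ⟨C, hC⟩ := hω.exists_sum_indicator_le hr
  have hd : 0 < 2 * p - 1 := by linarith
  -- This t maximises 2t - (2p-1)t²r, and the maximum is t itself.
  set t := 1 / ((2 * p - 1) * r) with ht
  have ht0 : 0 < t := by positivity
  have htr : (2 * p - 1) * t ^ 2 * r = t := by rw [ht]; field_simp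
  have hc0 : 0 ≤ (2 * p - 1) * t ^ 2 := by positivity
  have hC0 : 0 ≤ C := by simpa using hC 0
  refine ⟨(2 * p - 1) * t ^ 2 * C + (1 - 2 * t) ^ 2 / 4, fun z => ?_⟩
  have hzt : (z : ℝ) / ((2 * p - 1) * r) = t * z := by rw [ht]; ring
  rw [hzt]
  have h1 := sum_crossingTime_ge hp ω hω.values hKp hKr hK z.toNat
  have h2 := mul_le_mul_of_nonneg_left (hC z.toNat) hc0
  have h3 : (z : ℝ) ≤ (z.toNat : ℝ) := by exact_mod_cast Int.self_le_toNat z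
  have h4 := mul_le_mul_of_nonneg_left h3 ht0.le
  have h5 : (2 * p - 1) * t ^ 2 * (r * z.toNat + C) =
      t * z.toNat + (2 * p - 1) * t ^ 2 * C := by rw [mul_add, ← mul_assoc, htr]
  unfold hittingPotential
  linarith

/-! ### One-step transitions and expectations -/

lemma IsRandomWalk.measure_eq_and_eq {Ω : Type*} [MeasurableSpace Ω] {P : Measure Ω}
    [IsProbabilityMeasure P] {ω : ℤ → Set.Icc (0 : ℝ) 1} {x : ℤ} {X : ℕ → Ω → ℤ}
    (hX : IsRandomWalk P ω x X) (n : ℕ) (z y : ℤ) :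
    P {s | X n s = z ∧ X (n + 1) s = y} =
      P {s | X n s = z} * ENNReal.ofReal (stepProb ω z y) := by
  let T : Ω → (Fin n → ℤ) := fun s i => X i s
  have hT : Measurable T := measurable_pi_lambda _ fun i => hX.measurable i
  have hsum : ∀ A : Set Ω, MeasurableSet A → P A = ∑' b : Fin n → ℤ, P (A ∩ T ⁻¹' {b}) := by
    intro A hA
    rw [← measure_iUnion]
    · congr 1
      ext s
      simp
    · intro b c hbc
      refine Set.disjoint_left.2 fun s hs hs' => hbc ?_
      exact hs.2.symm.trans hs'.2
    · exact fun b => hA.inter (hT (measurableSet_singleton b))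
  have hm : MeasurableSet {s | X n s = z} := hX.measurable n (measurableSet_singleton z)
  have hm' : MeasurableSet {s | X (n + 1) s = y} :=
    hX.measurable (n + 1) (measurableSet_singleton y)
  rw [hsum {s | X n s = z ∧ X (n + 1) s = y} (hm.inter hm'), hsum _ hm, ← ENNReal.tsum_mul_right]
  refine tsum_congr fun b => ?_
  -- The path with past b and position z at time n; summing over b recovers the event on the present
  -- alone.
  let a : ℕ → ℤ := fun i => if h : i < n then b ⟨i, h⟩ else z
  have han : a n = z := by simp [a]
  have hpath : ∀ s, (∀ i ≤ n, X i s = a i) ↔ X n s = z ∧ T s = b := by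
    intro s
    constructor
    · intro h
      refine ⟨(h n le_rfl).trans han, funext fun i => ?_⟩
      simpa [a] using h i i.2.le
    · rintro ⟨h1, h2⟩ i hi
      rcases hi.lt_or_eq with h | rfl
      · simp only [a, h, dif_pos]
        exact congrFun h2 ⟨i, h⟩
      · rw [han, h1]
  have hstep := hX.step n a y
  rw [han] at hstep
  have e1 : {s | (∀ i ≤ n, X i s = a i) ∧ X (n + 1) s = y} =
      {s | X n s = z ∧ X (n + 1) s = y} ∩ T ⁻¹' {b} := by
    ext s
    simp only [Set.mem_ofPred_eq, hpath, Set.mem_inter_iff, Set.mem_preimage,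
      Set.mem_singleton_iff]
    tauto
  have e2 : {s | ∀ i ≤ n, X i s = a i} = {s | X n s = z} ∩ T ⁻¹' {b} := by
    ext s
    simp only [Set.mem_ofPred_eq, hpath, Set.mem_inter_iff, Set.mem_preimage,
      Set.mem_singleton_iff]
  rw [e1, e2] at hstep
  have h := congrArg ENNReal.ofReal hstep
  rw [ENNReal.ofReal_mul measureReal_nonneg, ofReal_measureReal, ofReal_measureReal] at h
  exact h

lemma tsum_mul_stepProb (ω : ℤ → Set.Icc (0 : ℝ) 1) (g : ℤ → ENNReal) (z : ℤ) :
    ∑' y, g y * ENNReal.ofReal (stepProb ω z y) =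
      g (z + 1) * ENNReal.ofReal (ω z) + g (z - 1) * ENNReal.ofReal (1 - (ω z : ℝ)) := by
  have hne : z + 1 ≠ z - 1 := by omega
  rw [tsum_eq_sum (s := {z + 1, z - 1}), Finset.sum_pair hne]
  · simp [stepProb, hne.symm]
  · intro y hy
    simp only [Finset.mem_insert, Finset.mem_singleton, not_or] at hy
    simp [stepProb, hy.1, hy.2]

lemma lintegral_comp_int {Ω : Type*} [MeasurableSpace Ω] (P : Measure Ω) {Y : Ω → ℤ}
    (hY : Measurable Y) (g : ℤ → ENNReal) :
    ∫⁻ s, g (Y s) ∂P = ∑' z, g z * P {s | Y s = z} := by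
  rw [← lintegral_map Measurable.of_discrete hY, lintegral_countable']
  refine tsum_congr fun z => ?_
  rw [Measure.map_apply hY (measurableSet_singleton z)]
  rfl

lemma IsRandomWalk.lintegral_succ {Ω : Type*} [MeasurableSpace Ω] {P : Measure Ω}
    [IsProbabilityMeasure P] {ω : ℤ → Set.Icc (0 : ℝ) 1} {x : ℤ} {X : ℕ → Ω → ℤ}
    (hX : IsRandomWalk P ω x X) (n : ℕ) (g : ℤ → ENNReal) :
    ∫⁻ s, g (X (n + 1) s) ∂P = ∫⁻ s, (g (X n s + 1) * ENNReal.ofReal (ω (X n s)) +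
      g (X n s - 1) * ENNReal.ofReal (1 - (ω (X n s) : ℝ))) ∂P := by
  have hy : ∀ y, P {s | X (n + 1) s = y} =
      ∑' z, P {s | X n s = z} * ENNReal.ofReal (stepProb ω z y) := by
    intro y
    simp_rw [← hX.measure_eq_and_eq]
    rw [← measure_iUnion]
    · congr 1
      ext s
      simp
    · intro b c hbc
      refine Set.disjoint_left.2 fun s hs hs' => hbc ?_
      exact hs.1.symm.trans hs'.1
    · exact fun z => (hX.measurable n (measurableSet_singleton z)).inter
        (hX.measurable (n + 1) (measurableSet_singleton y))
  rw [lintegral_comp_int P (hX.measurable (n + 1)) g,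
    lintegral_comp_int P (hX.measurable n) fun z => g (z + 1) * ENNReal.ofReal (ω z) +
      g (z - 1) * ENNReal.ofReal (1 - (ω z : ℝ))]
  simp_rw [hy, ← ENNReal.tsum_mul_left, ← tsum_mul_stepProb, ← ENNReal.tsum_mul_right]
  rw [ENNReal.tsum_comm]
  refine tsum_congr fun z => tsum_congr fun y => ?_
  ring

/-! ### Exponential moments and Borel–Cantelli -/

/-- Average e^u ≤ 1 + u + u², valid for |u| ≤ 1, over the two jumps: the drift bounds the linear
term by θ. -/
lemma exp_step_le {w a b θ K : ℝ} (hw0 : 0 ≤ w) (hw1 : w ≤ 1) (ha : a ∈ Set.Icc 0 K)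
    (hb : b ∈ Set.Icc 0 K) (hdrift : w * a - (1 - w) * b ≤ 1) (hθ : 0 ≤ θ) (hθK : θ * K ≤ 1) :
    Real.exp (θ * a) * w + Real.exp (-(θ * b)) * (1 - w) ≤ Real.exp (θ + (θ * K) ^ 2) := by
  have hq : 0 ≤ 1 - w := sub_nonneg.2 hw1
  have bound : ∀ u : ℝ, |u| ≤ θ * K → Real.exp u ≤ 1 + u + (θ * K) ^ 2 := by
    intro u hu
    have h1 := (abs_le.1 (Real.abs_exp_sub_one_sub_id_le (hu.trans hθK))).2
    have h2 : u ^ 2 ≤ (θ * K) ^ 2 := by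
      rw [← sq_abs u]
      exact pow_le_pow_left₀ (abs_nonneg u) hu 2
    linarith
  have h1 := bound (θ * a) (by
    rw [abs_of_nonneg (mul_nonneg hθ ha.1)]
    exact mul_le_mul_of_nonneg_left ha.2 hθ)
  have h2 := bound (-(θ * b)) (by
    rw [abs_neg, abs_of_nonneg (mul_nonneg hθ hb.1)]
    exact mul_le_mul_of_nonneg_left hb.2 hθ)
  have h3 := mul_le_mul_of_nonneg_right h1 hw0
  have h4 := mul_le_mul_of_nonneg_right h2 hq
  have h5 := mul_le_mul_of_nonneg_left hdrift hθ
  have h6 := Real.add_one_le_exp (θ + (θ * K) ^ 2)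
  linarith

lemma IsRandomWalk.lintegral_exp_hittingPotential_le {Ω : Type*} [MeasurableSpace Ω]
    {P : Measure Ω} [IsProbabilityMeasure P] {ω : ℤ → Set.Icc (0 : ℝ) 1} {x : ℤ}
    {X : ℕ → Ω → ℤ} (hX : IsRandomWalk P ω x X) (hpos : ∀ z, 0 < (ω z : ℝ)) {K θ : ℝ}
    (hK : 0 ≤ K) (hθ : 0 ≤ θ) (hθK : θ * K ≤ 1) (n : ℕ) :
    ∫⁻ s, ENNReal.ofReal (Real.exp (θ * hittingPotential ω K (X n s))) ∂P ≤
      ENNReal.ofReal (Real.exp (θ * hittingPotential ω K x + n * (θ + (θ * K) ^ 2))) := by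
  induction n with
  | zero =>
    rw [lintegral_congr_ae (g := fun _ => ENNReal.ofReal
      (Real.exp (θ * hittingPotential ω K x)))]
    · simp
    · filter_upwards [hX.start] with s hs
      rw [hs]
  | succ n ih =>
    rw [hX.lintegral_succ n fun z => ENNReal.ofReal (Real.exp (θ * hittingPotential ω K z))]
    calc _ ≤ ∫⁻ s, ENNReal.ofReal (Real.exp (θ * hittingPotential ω K (X n s))) *
          ENNReal.ofReal (Real.exp (θ + (θ * K) ^ 2)) ∂P := by
          refine lintegral_mono fun s => ?_
          generalize X n s = z
          have h0 := (ω z).2.1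
          have h1 := sub_nonneg.2 (ω z).2.2
          rw [← ENNReal.ofReal_mul (Real.exp_nonneg _), ← ENNReal.ofReal_mul (Real.exp_nonneg _),
            ← ENNReal.ofReal_add (by positivity) (by positivity),
            ← ENNReal.ofReal_mul (Real.exp_nonneg _)]
          refine ENNReal.ofReal_le_ofReal ?_
          have h := exp_step_le h0 (ω z).2.2 (crossingTime_mem_Icc ω hK (z + 1).toNat)
            (crossingTime_mem_Icc ω hK z.toNat) (crossingTime_drift_le_one ω K z (hpos z))
            hθ hθK
          have h' := mul_le_mul_of_nonneg_left h
            (Real.exp_nonneg (θ * hittingPotential ω K z))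
          refine le_trans (le_of_eq ?_) h'
          rw [hittingPotential_add_one, hittingPotential_sub_one, mul_add θ, mul_sub θ,
            sub_eq_add_neg, Real.exp_add, Real.exp_add]
          ring
      _ = (∫⁻ s, ENNReal.ofReal (Real.exp (θ * hittingPotential ω K (X n s))) ∂P) *
          ENNReal.ofReal (Real.exp (θ + (θ * K) ^ 2)) := by
          rw [lintegral_mul_const' _ _ ENNReal.ofReal_ne_top]
      _ ≤ _ := mul_le_mul_left ih _
      _ = _ := by
          rw [← ENNReal.ofReal_mul (Real.exp_nonneg _), ← Real.exp_add]
          push_cast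
          ring_nf

lemma IsRandomWalk.ae_eventually_hittingPotential_le {Ω : Type*} [MeasurableSpace Ω]
    {P : Measure Ω} [IsProbabilityMeasure P] {ω : ℤ → Set.Icc (0 : ℝ) 1} {x : ℤ}
    {X : ℕ → Ω → ℤ} (hX : IsRandomWalk P ω x X) (hpos : ∀ z, 0 < (ω z : ℝ)) {K ε : ℝ}
    (hK : 1 ≤ K) (hε : 0 < ε) (hε1 : ε ≤ 1) :
    ∀ᵐ s ∂P, ∀ᶠ n : ℕ in atTop, hittingPotential ω K (X n s) ≤ (1 + ε) * n := by
  have hK0 : 0 < K := by linarith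
  -- With this θ the second-order cost (θK)² is θε/2, half of the available margin θε; the other
  -- half gives the geometric ratio c.
  set θ := ε / (2 * K ^ 2) with hθ
  have hθ0 : 0 < θ := by positivity
  have hθK : θ * K ≤ 1 := by
    rw [hθ, div_mul_eq_mul_div, div_le_one (by positivity)]
    nlinarith
  have hθ2 : (θ * K) ^ 2 = θ * ε / 2 := by rw [hθ]; field_simp
  set c := Real.exp (-(θ * ε / 2)) with hc
  have hc1 : c < 1 := by rw [hc, Real.exp_lt_one_iff]; have := mul_pos hθ0 hε; linarith
  have hbound : ∀ n : ℕ, P {s | (1 + ε) * n < hittingPotential ω K (X n s)} ≤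
      ENNReal.ofReal (Real.exp (θ * hittingPotential ω K x) * c ^ n) := by
    intro n
    have h1 := hX.lintegral_exp_hittingPotential_le hpos hK0.le hθ0.le hθK n
    have h2 := mul_meas_ge_le_lintegral₀ (μ := P)
      (f := fun s => ENNReal.ofReal (Real.exp (θ * hittingPotential ω K (X n s))))
      ((Measurable.of_discrete (f := fun z => ENNReal.ofReal
        (Real.exp (θ * hittingPotential ω K z)))).comp (hX.measurable n)).aemeasurable
      (ENNReal.ofReal (Real.exp (θ * ((1 + ε) * n))))
    have h3 : P {s | (1 + ε) * n < hittingPotential ω K (X n s)} ≤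
        P {s | ENNReal.ofReal (Real.exp (θ * ((1 + ε) * n))) ≤
          ENNReal.ofReal (Real.exp (θ * hittingPotential ω K (X n s)))} :=
      measure_mono fun s hs => ENNReal.ofReal_le_ofReal
        (Real.exp_le_exp.2 (mul_le_mul_of_nonneg_left (le_of_lt hs) hθ0.le))
    have h4 := (mul_le_mul_right h3 _).trans (h2.trans h1)
    have hpos' : ENNReal.ofReal (Real.exp (θ * ((1 + ε) * n))) ≠ 0 := by
      simp [Real.exp_pos]
    rw [mul_comm, ← ENNReal.le_div_iff_mul_le (Or.inl hpos') (Or.inl ENNReal.ofReal_ne_top),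
      ← ENNReal.ofReal_div_of_pos (Real.exp_pos _), ← Real.exp_sub] at h4
    refine h4.trans (le_of_eq ?_)
    rw [hc, ← Real.exp_nat_mul, ← Real.exp_add, hθ2]
    congr 2
    ring
  have hsum : ∑' n : ℕ, P {s | (1 + ε) * n < hittingPotential ω K (X n s)} ≠ ⊤ := by
    refine ne_top_of_le_ne_top ?_ (ENNReal.tsum_le_tsum hbound)
    exact ((summable_geometric_of_lt_one (Real.exp_nonneg _) hc1).mul_left _).tsum_ofReal_ne_top
  filter_upwards [ae_eventually_notMem hsum] with s hs
  filter_upwards [hs] with n hn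
  exact not_lt.1 hn

/-! ### The speed bound -/

lemma IsRandomWalk.ae_limsup_div_le {p lam : ℝ} (hp : 1 / 2 < p)
    {ω : ℤ → Set.Icc (0 : ℝ) 1} (hω : IsEnvironment p lam ω) {x : ℤ}
    {Ω : Type*} [MeasurableSpace Ω] {P : Measure Ω} [IsProbabilityMeasure P]
    {X : ℕ → Ω → ℤ} (hX : IsRandomWalk P ω x X) {r ε : ℝ} (hr : lam < r) (hr0 : 0 < r)
    (hε : 0 < ε) (hε1 : ε ≤ 1) :
    ∀ᵐ s ∂P, limsup (fun n : ℕ => (((X n s : ℝ) / (n : ℝ) : ℝ) : EReal)) atTop ≤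
      (((2 * p - 1) * r * (1 + 2 * ε) : ℝ) : EReal) := by
  have hd : 0 < 2 * p - 1 := by linarith
  have ht : 0 < 1 / ((2 * p - 1) * r) := by positivity
  have hd' : 0 < 1 / (2 * p - 1) := by positivity
  set K := 1 / (2 * p - 1) + (2 * (1 / ((2 * p - 1) * r)) + 1)
  have hpos : ∀ z, 0 < (ω z : ℝ) := fun z => by
    rcases hω.values z with h | h <;> rw [h] <;> linarith
  obtain ⟨C, hC⟩ := hω.exists_le_hittingPotential hp hr hr0 (K := K) (by linarith) (by linarith)
    (by linarith)
  filter_upwards [hX.ae_eventually_hittingPotential_le hpos (K := K) (by linarith) hε hε1]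
    with s hs
  refine limsup_le_of_le (h := ?_)
  have hlarge : ∀ᶠ n : ℕ in atTop, C / ε ≤ n :=
    tendsto_natCast_atTop_atTop.eventually_ge_atTop (C / ε)
  filter_upwards [hs, hlarge, eventually_gt_atTop 0] with n h1 h2 h3
  have hn : (0 : ℝ) < n := by exact_mod_cast h3
  rw [EReal.coe_le_coe_iff, div_le_iff₀ hn]
  have h4 := hC (X n s)
  rw [div_le_iff₀ hε] at h2
  -- One ε comes from the bound on the potential, the other absorbs C ≤ εn.
  have h5 : (X n s : ℝ) / ((2 * p - 1) * r) ≤ (1 + 2 * ε) * n := by linarith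
  rw [div_le_iff₀ (by positivity)] at h5
  linarith

theorem theorem1p2 (p lam : ℝ) (hp : 1 / 2 < p) (hp1 : p ≤ 1)
    (hlam0 : 0 ≤ lam) (hlam1 : lam ≤ 1)
    (ω : ℤ → Set.Icc (0 : ℝ) 1) (hω : IsEnvironment p lam ω) (x : ℤ)
    {Ω : Type*} [MeasurableSpace Ω] (P : Measure Ω) [IsProbabilityMeasure P]
    (X : ℕ → Ω → ℤ) (hX : IsRandomWalk P ω x X) :
    ∀ᵐ s ∂P, limsup (fun n : ℕ => (((X n s : ℝ) / (n : ℝ) : ℝ) : EReal)) atTop ≤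
      (((2 * p - 1) * lam : ℝ) : EReal) := by
  -- Taking r = λ + 1/(m+1) keeps r > 0 even when λ = 0, and countably many m need only one null
  -- set.
  have hall : ∀ᵐ s ∂P, ∀ m : ℕ,
      limsup (fun n : ℕ => (((X n s : ℝ) / (n : ℝ) : ℝ) : EReal)) atTop ≤
        (((2 * p - 1) * (lam + 1 / ((m : ℝ) + 1)) * (1 + 2 * (1 / ((m : ℝ) + 1))) : ℝ) :
          EReal) := by
    refine ae_all_iff.2 fun m => ?_
    have hm : 0 < 1 / ((m : ℝ) + 1) := by positivity
    refine hX.ae_limsup_div_le hp hω (by linarith) (by linarith) hm ?_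
    rw [div_le_one (by positivity)]
    linarith [(m.cast_nonneg : (0 : ℝ) ≤ m)]
  filter_upwards [hall] with s hs
  have h := tendsto_one_div_add_atTop_nhds_zero_nat (𝕜 := ℝ)
  have h' := ((h.const_add lam).const_mul (2 * p - 1)).mul ((h.const_mul 2).const_add 1)
  simp only [add_zero, mul_zero, mul_one] at h'
  exact ge_of_tendsto' (EReal.tendsto_coe.2 h') hs
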